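/- Let $s \in \{\tfrac12, 1, \tfrac32, \dots\}$ be a positive integer or half-integer and let $V_s$ be a finite-dimensional irreducible complex representation of the Lie algebra $sl_2$ of dimension $2s+1$. For $j = 0, 1, \dots, 2s$ let $P^j$ be the projector of $V_s \otimes V_s$ onto its subspace of spin $j$ (the sum of all irreducible subrepresentations of dimension $2j+1$), along the sum of the subspaces of all other spins. An $sl_2$-invariant constant R-matrix is an operator $R \in \mathrm{End}(V_s \otimes V_s)$ of the form $$R = \sum_{j=0}^{2s} r_j P^j, \qquad r_j \in \mathbb{C},$$ that satisfies the constant Yang–Baxter equation $$R_{12} R_{23} R_{12} = R_{23} R_{12} R_{23}$$ on $V_s \otimes V_s \otimes V_s$, where $R_{12} = R \otimes \mathrm{id}$ and $R_{23} = \mathrm{id} \otimes R$. Then there is no nonzero $sl_2$-invariant constant R-matrix with $r_{2s} = 0$. -/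

import Mathlib

open scoped TensorProduct

/-- The complex Lie algebra `sl₂` of traceless `2 × 2` matrices. -/
abbrev Sl2 : Type := LieAlgebra.SpecialLinear.sl (Fin 2) ℂ

namespace Sl2

/-- The raising element. -/
def E : Sl2 := LieAlgebra.SpecialLinear.single (0 : Fin 2) 1 (by decide) 1

/-- The lowering element. -/
def F : Sl2 := LieAlgebra.SpecialLinear.single (1 : Fin 2) 0 (by decide) 1

/-- The diagonal element. -/
def H : Sl2 := LieAlgebra.SpecialLinear.singleSubSingle (0 : Fin 2) 1 1

theorem triple : IsSl2Triple H E F where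
  h_ne_zero := by
    intro h
    have := congrArg (fun x : Sl2 => x.val 0 0) h
    simp [H] at this
  lie_e_f := by
    ext i j
    rw [LieAlgebra.SpecialLinear.sl_bracket]
    fin_cases i <;> fin_cases j <;> simp [H, E, F, Matrix.mul_apply, Matrix.single_apply]
  lie_h_e_nsmul := by
    ext i j
    rw [LieAlgebra.SpecialLinear.sl_bracket]
    fin_cases i <;> fin_cases j <;> simp [H, E, Matrix.mul_apply, Matrix.single_apply]
    all_goals norm_num
  lie_h_f_nsmul := by
    ext i j
    rw [LieAlgebra.SpecialLinear.sl_bracket]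
    fin_cases i <;> fin_cases j <;> simp [H, F, Matrix.mul_apply, Matrix.single_apply]
    all_goals norm_num

theorem eq_comb (x : Sl2) : x = x.val 0 1 • E + x.val 1 0 • F + x.val 0 0 • H := by
  have hx : Matrix.trace x.val = 0 := x.property
  rw [Matrix.trace_fin_two] at hx
  ext i j
  fin_cases i <;> fin_cases j <;> simp [H, E, F, Matrix.single_apply]
  linear_combination hx

variable {M : Type*} [AddCommGroup M] [Module ℂ M] [LieRingModule Sl2 M] [LieModule ℂ Sl2 M]

theorem lie_mem_of {U : Submodule ℂ M} (he : ∀ m ∈ U, ⁅E, m⁆ ∈ U) (hf : ∀ m ∈ U, ⁅F, m⁆ ∈ U)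
    (hh : ∀ m ∈ U, ⁅H, m⁆ ∈ U) (x : Sl2) {m : M} (hm : m ∈ U) : ⁅x, m⁆ ∈ U := by
  rw [eq_comb x]
  simp only [add_lie, smul_lie]
  exact U.add_mem (U.add_mem (U.smul_mem _ (he m hm)) (U.smul_mem _ (hf m hm)))
    (U.smul_mem _ (hh m hm))

/-- The orbit of a vector under powers of the lowering element. -/
def desc (v : M) (k : ℕ) : M := ((LieModule.toEnd ℂ Sl2 M F) ^ k) v

section Primitive

variable [FiniteDimensional ℂ M] {v : M} {N : ℕ}

theorem lie_F_desc (v : M) (k : ℕ) : ⁅F, desc v k⁆ = desc v (k + 1) := by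
  simp [desc, pow_succ']

theorem lie_H_desc (P : triple.HasPrimitiveVectorWith v (N : ℂ)) (k : ℕ) :
    ⁅H, desc v k⁆ = ((N : ℂ) - 2 * k) • desc v k := P.lie_h_pow_toEnd_f k

theorem lie_E_desc (P : triple.HasPrimitiveVectorWith v (N : ℂ)) (k : ℕ) :
    ⁅E, desc v k⁆ = ((k : ℂ) * (N - k + 1)) • desc v (k - 1) := by
  cases k with
  | zero => simpa [desc] using P.lie_e
  | succ k =>
    have := P.lie_e_pow_succ_toEnd_f k
    simp only [desc, Nat.add_sub_cancel]
    rw [this]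
    congr 1
    push_cast
    ring

theorem desc_eq_zero (P : triple.HasPrimitiveVectorWith v (N : ℂ)) : desc v (N + 1) = 0 :=
  P.pow_toEnd_f_eq_zero_of_eq_nat rfl

theorem desc_linearIndependent (P : triple.HasPrimitiveVectorWith v (N : ℂ)) :
    LinearIndependent ℂ (fun k : Fin (N + 1) => desc v k) := by
  refine Module.End.eigenvectors_linearIndependent' (LieModule.toEnd ℂ Sl2 M H)
    (fun k : Fin (N + 1) => (N : ℂ) - 2 * (k : ℕ)) ?_ _ ?_
  · intro a b hab
    have : ((a : ℕ) : ℂ) = (b : ℕ) := by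
      have h2 : (N : ℂ) - 2 * (a : ℕ) = N - 2 * (b : ℕ) := hab
      linear_combination (-1 / 2) * h2
    exact Fin.ext (by exact_mod_cast this)
  · intro k
    refine ⟨?_, P.pow_toEnd_f_ne_zero_of_eq_nat rfl (Nat.lt_succ_iff.mp k.2)⟩
    rw [Module.End.mem_eigenspace_iff]
    exact lie_H_desc P k

/-- The Lie submodule generated by a primitive vector. -/
def cyc (P : triple.HasPrimitiveVectorWith v (N : ℂ)) : LieSubmodule ℂ Sl2 M where
  toSubmodule := Submodule.span ℂ (Set.range fun k : Fin (N + 1) => desc v k)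
  lie_mem := by
    intro x m hm
    have key : ∀ k : ℕ, k ≤ N →
        desc v k ∈ Submodule.span ℂ (Set.range fun k : Fin (N + 1) => desc v k) := fun k hk =>
      Submodule.subset_span ⟨⟨k, by omega⟩, rfl⟩
    refine lie_mem_of ?_ ?_ ?_ x hm
    · intro m hm
      induction hm using Submodule.span_induction with
      | mem m h =>
        obtain ⟨k, rfl⟩ := h
        dsimp only
        rw [lie_E_desc P]
        exact Submodule.smul_mem _ _ (key _ (by omega))
      | zero => simp
      | add a b _ _ ha hb => rw [lie_add]; exact Submodule.add_mem _ ha hb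
      | smul c a _ ha => rw [lie_smul]; exact Submodule.smul_mem _ _ ha
    · intro m hm
      induction hm using Submodule.span_induction with
      | mem m h =>
        obtain ⟨k, rfl⟩ := h
        dsimp only
        rw [lie_F_desc]
        by_cases hk : (k : ℕ) = N
        · rw [hk, desc_eq_zero P]; exact Submodule.zero_mem _
        · exact key _ (by omega)
      | zero => simp
      | add a b _ _ ha hb => rw [lie_add]; exact Submodule.add_mem _ ha hb
      | smul c a _ ha => rw [lie_smul]; exact Submodule.smul_mem _ _ ha
    · intro m hm
      induction hm using Submodule.span_induction with
      | mem m h =>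
        obtain ⟨k, rfl⟩ := h
        dsimp only
        rw [lie_H_desc P]
        exact Submodule.smul_mem _ _ (key _ (by omega))
      | zero => simp
      | add a b _ _ ha hb => rw [lie_add]; exact Submodule.add_mem _ ha hb
      | smul c a _ ha => rw [lie_smul]; exact Submodule.smul_mem _ _ ha

theorem finrank_cyc (P : triple.HasPrimitiveVectorWith v (N : ℂ)) :
    Module.finrank ℂ (cyc P) = N + 1 := by
  have := finrank_span_eq_card (desc_linearIndependent P)
  rw [Fintype.card_fin] at this
  exact this

theorem cyc_le (P : triple.HasPrimitiveVectorWith v (N : ℂ)) {U : LieSubmodule ℂ Sl2 M}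
    (hv : v ∈ U) : cyc P ≤ U := by
  have key : ∀ k : ℕ, desc v k ∈ U := by
    intro k
    induction k with
    | zero => simpa [desc] using hv
    | succ k ih => rw [← lie_F_desc]; exact U.lie_mem ih
  have h : Submodule.span ℂ (Set.range fun k : Fin (N + 1) => desc v k) ≤ U.toSubmodule :=
    Submodule.span_le.mpr (by rintro _ ⟨k, rfl⟩; exact key k)
  exact h

theorem exists_primitive {U : LieSubmodule ℂ Sl2 M} (hU : U ≠ ⊥) :
    ∃ (d : ℕ) (u : M), u ∈ U ∧ triple.HasPrimitiveVectorWith u (d : ℂ) := by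
  have : Nontrivial U := (LieSubmodule.nontrivial_iff_ne_bot ℂ Sl2 M).mpr hU
  obtain ⟨μ, m, hm, P⟩ := IsSl2Triple.exists_hasPrimitiveVectorWith (R := ℂ) (M := U) triple
  obtain ⟨d, rfl⟩ := P.exists_nat
  refine ⟨d, m, m.2, ⟨by simpa using hm, ?_, ?_⟩⟩
  · simpa using congrArg (Subtype.val) P.lie_h
  · simpa using congrArg (Subtype.val) P.lie_e

theorem mem_of_lie_E_eq_zero (P : triple.HasPrimitiveVectorWith v (N : ℂ)) {u : M}
    (hu : u ∈ cyc P) (he : ⁅E, u⁆ = 0) : ∃ c : ℂ, u = c • v := by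
  have hu' : u ∈ Submodule.span ℂ (Set.range fun k : Fin (N + 1) => desc v k) := hu
  obtain ⟨c, rfl⟩ := (Submodule.mem_span_range_iff_exists_fun ℂ).mp hu'
  rw [Fin.sum_univ_succ] at he ⊢
  have h0 : ⁅E, desc v 0⁆ = 0 := by simpa [desc] using P.lie_e
  have he' : ∑ i : Fin N, (c i.succ * (((i : ℕ) + 1 : ℂ) * (N - (i : ℕ)))) • desc v i = 0 := by
    rw [← he, lie_add, lie_smul, Fin.val_zero, h0, smul_zero, zero_add, lie_sum]
    refine Finset.sum_congr rfl fun i _ => ?_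
    rw [lie_smul, lie_E_desc P, smul_smul, Fin.val_succ, Nat.add_sub_cancel]
    congr 2
    push_cast
    ring
  have li : LinearIndependent ℂ (fun k : Fin N => desc v k) := by
    have := (desc_linearIndependent P).comp (Fin.castSucc : Fin N → Fin (N + 1))
      (Fin.castSucc_injective N)
    exact this
  have hc := Fintype.linearIndependent_iff.mp li _ he'
  have hc' : ∀ i : Fin N, c i.succ = 0 := by
    intro i
    rcases mul_eq_zero.mp (hc i) with h | h
    · exact h
    · exfalso
      rcases mul_eq_zero.mp h with h | h
      · exact Nat.cast_add_one_ne_zero (R := ℂ) _ h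
      · have h3 : (N : ℂ) = (i : ℕ) := sub_eq_zero.mp h
        have h4 : N = (i : ℕ) := by exact_mod_cast h3
        omega
  exact ⟨c 0, by simp [hc', desc]⟩

theorem cyc_irreducible (P : triple.HasPrimitiveVectorWith v (N : ℂ)) :
    LieModule.IsIrreducible ℂ Sl2 (cyc P) := by
  have : Nontrivial (cyc P) := Module.nontrivial_of_finrank_pos (R := ℂ)
    (by rw [finrank_cyc]; omega)
  refine LieModule.IsIrreducible.mk fun U hU => ?_
  obtain ⟨d, u, huU, Q⟩ := exists_primitive hU
  have he : ⁅E, (u : M)⁆ = 0 := by simpa using congrArg Subtype.val Q.lie_e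
  obtain ⟨c, hc⟩ := mem_of_lie_E_eq_zero P u.2 he
  have hc0 : c ≠ 0 := by
    rintro rfl
    exact Q.ne_zero (Subtype.ext (by simpa using hc))
  have hvU : v ∈ U.map (cyc P).incl := by
    have h : (u : M) ∈ U.map (cyc P).incl := (LieSubmodule.mem_map _).mpr ⟨u, huU, rfl⟩
    have h2 := (U.map (cyc P).incl).smul_mem c⁻¹ h
    rwa [hc, smul_smul, inv_mul_cancel₀ hc0, one_smul] at h2
  have hle := cyc_le P hvU
  rw [eq_top_iff]
  rintro ⟨x, hx⟩ -
  obtain ⟨y, hy, hyx⟩ := (LieSubmodule.mem_map _).mp (hle hx)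
  have : y = ⟨x, hx⟩ := Subtype.ext hyx
  rwa [← this]

theorem exists_cyc_eq {U : LieSubmodule ℂ Sl2 M} (hU : LieModule.IsIrreducible ℂ Sl2 U) :
    ∃ (d : ℕ) (u : M) (P : triple.HasPrimitiveVectorWith u (d : ℂ)), U = cyc P := by
  have hne : U ≠ ⊥ := by
    rintro rfl
    exact bot_ne_top (Subsingleton.elim (⊥ : LieSubmodule ℂ Sl2 (⊥ : LieSubmodule ℂ Sl2 M)) ⊤)
  obtain ⟨d, u, hu, P⟩ := exists_primitive hne
  refine ⟨d, u, P, le_antisymm ?_ (cyc_le P hu)⟩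
  have h := hU.eq_bot_or_eq_top ((cyc P).comap U.incl)
  rcases h with h | h
  · exfalso
    have h1 : (⟨u, hu⟩ : U) ∈ (cyc P).comap U.incl := by
      rw [LieSubmodule.mem_comap]
      have : desc u 0 ∈ Submodule.span ℂ (Set.range fun k : Fin (d + 1) => desc u k) :=
        Submodule.subset_span ⟨0, rfl⟩
      exact this
    rw [h, LieSubmodule.mem_bot] at h1
    exact P.ne_zero (congrArg Subtype.val h1)
  · intro x hx
    have h1 : (⟨x, hx⟩ : U) ∈ (cyc P).comap U.incl := by rw [h]; exact LieSubmodule.mem_top _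
    simpa [LieSubmodule.mem_comap] using h1

end Primitive

variable (M) in
/-- The subspace of spin `j` (for an integer `j`) of an `sl₂`-module: the sum of all irreducible
submodules of dimension `2 * j + 1`. -/
def spinSubspace (j : ℕ) : Submodule ℂ M :=
  ⨆ (U : LieSubmodule ℂ Sl2 M) (_ : LieModule.IsIrreducible ℂ Sl2 U)
    (_ : Module.finrank ℂ U = 2 * j + 1), U.toSubmodule

variable (M) in
/-- The Casimir operator `E F + F E + H ^ 2 / 2`; it only serves to prove that the subspaces of
different spins are independent. -/
noncomputable def casimir : Module.End ℂ M :=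
  LieModule.toEnd ℂ Sl2 M E * LieModule.toEnd ℂ Sl2 M F +
    LieModule.toEnd ℂ Sl2 M F * LieModule.toEnd ℂ Sl2 M E +
    (1 / 2 : ℂ) • (LieModule.toEnd ℂ Sl2 M H * LieModule.toEnd ℂ Sl2 M H)

section Decomposition

variable [FiniteDimensional ℂ M]

theorem casimir_desc {v : M} {N : ℕ} (P : triple.HasPrimitiveVectorWith v (N : ℂ)) (k : ℕ) :
    casimir M (desc v k) = ((N : ℂ) * (N + 2) / 2) • desc v k := by
  have h1 : ⁅E, ⁅F, desc v k⁆⁆ = (((k : ℂ) + 1) * (N - k)) • desc v k := by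
    rw [lie_F_desc, lie_E_desc P, Nat.add_sub_cancel]
    congr 1; push_cast; ring
  have h2 : ⁅F, ⁅E, desc v k⁆⁆ = ((k : ℂ) * (N - k + 1)) • desc v k := by
    rw [lie_E_desc P, lie_smul, lie_F_desc]
    cases k with
    | zero => simp
    | succ k => simp
  simp only [casimir, LinearMap.add_apply, Module.End.mul_apply, LinearMap.smul_apply,
    LieModule.toEnd_apply_apply]
  rw [h1, h2, lie_H_desc P, lie_smul, lie_H_desc P, smul_smul, smul_smul, ← add_smul, ← add_smul]
  congr 1
  ring

theorem spinSubspace_le (j : ℕ) :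
    spinSubspace M j ≤ (casimir M).eigenspace ((2 * j : ℂ) * (2 * j + 2) / 2) := by
  refine iSup_le fun U => iSup_le fun hU => iSup_le fun hd => ?_
  obtain ⟨d, u, P, rfl⟩ := exists_cyc_eq hU
  rw [finrank_cyc] at hd
  obtain rfl : d = 2 * j := by omega
  have h : Submodule.span ℂ (Set.range fun k : Fin (2 * j + 1) => desc u k) ≤
      (casimir M).eigenspace ((2 * j : ℂ) * (2 * j + 2) / 2) := by
    refine Submodule.span_le.mpr ?_
    rintro _ ⟨k, rfl⟩
    rw [SetLike.mem_coe, Module.End.mem_eigenspace_iff, casimir_desc P]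
    push_cast
    rfl
  exact h

theorem iSupIndep_spinSubspace : iSupIndep (spinSubspace M) := by
  have h := (casimir M).eigenspaces_iSupIndep.comp
    (f := fun j : ℕ => (2 * j : ℂ) * (2 * j + 2) / 2) (by
      intro a b hab
      have h1 : (2 * a : ℂ) * (2 * a + 2) / 2 = (2 * b : ℂ) * (2 * b + 2) / 2 := hab
      have h2 : ((a : ℂ) * (a + 1)) = b * (b + 1) := by linear_combination h1 / 2
      have h3 : a * (a + 1) = b * (b + 1) := by exact_mod_cast h2
      nlinarith [h3, lt_trichotomy a b])
  exact h.mono fun j => spinSubspace_le j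

end Decomposition

section Square

variable (V : Type*) [AddCommGroup V] [Module ℂ V] [LieRingModule Sl2 V] [LieModule ℂ Sl2 V]
  [FiniteDimensional ℂ V]

theorem exists_top [LieModule.IsIrreducible ℂ Sl2 V] :
    ∃ (d : ℕ) (u : V), triple.HasPrimitiveVectorWith u (d : ℂ) ∧ Module.finrank ℂ V = d + 1 := by
  obtain ⟨d, u, -, P⟩ := exists_primitive (M := V) (U := ⊤) top_ne_bot
  refine ⟨d, u, P, ?_⟩
  have h : cyc P = ⊤ := by
    refine (IsSimpleOrder.eq_bot_or_eq_top (cyc P)).resolve_left fun h => ?_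
    have := finrank_cyc P
    rw [h] at this
    rw [show Module.finrank ℂ (⊥ : LieSubmodule ℂ Sl2 V) = 0 from finrank_bot ℂ V] at this
    omega
  rw [← finrank_cyc P, h]
  exact finrank_top ℂ V |>.symm

variable {V}

/-- The coefficients of a highest weight vector in the tensor square. -/
noncomputable def hwCoeff (n k i : ℕ) : ℂ :=
  (-1) ^ i * ((n - i).factorial * (n - k + i).factorial : ℕ) /
    ((i.factorial * (k - i).factorial : ℕ) : ℂ)

theorem hwCoeff_rec {n k i : ℕ} (hk : k ≤ n) (hi : i < k) :
    hwCoeff n k (i + 1) * (((i + 1 : ℕ) : ℂ) * (n - (i + 1 : ℕ) + 1)) +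
      hwCoeff n k i * (((k - i : ℕ) : ℂ) * (n - (k - i : ℕ) + 1)) = 0 := by
  obtain ⟨a, rfl⟩ : ∃ a, k = i + 1 + a := ⟨k - i - 1, by omega⟩
  obtain ⟨b, rfl⟩ : ∃ b, n = i + 1 + a + b := ⟨n - (i + 1 + a), by omega⟩
  have e1 : i + 1 + a + b - (i + 1) = a + b := by omega
  have e2 : i + 1 + a + b - i = a + b + 1 := by omega
  have e3 : i + 1 + a + b - (i + 1 + a) + (i + 1) = b + i + 1 := by omega
  have e4 : i + 1 + a + b - (i + 1 + a) + i = b + i := by omega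
  have e5 : i + 1 + a - (i + 1) = a := by omega
  have e6 : i + 1 + a - i = a + 1 := by omega
  simp only [hwCoeff, e1, e2, e3, e4, e5, e6, Nat.factorial_succ]
  have h1 : ((i.factorial : ℕ) : ℂ) ≠ 0 := by exact_mod_cast i.factorial_ne_zero
  have h2 : ((a.factorial : ℕ) : ℂ) ≠ 0 := by exact_mod_cast a.factorial_ne_zero
  have h3 : (i : ℂ) + 1 ≠ 0 := Nat.cast_add_one_ne_zero i
  have h4 : (a : ℂ) + 1 ≠ 0 := Nat.cast_add_one_ne_zero a
  push_cast
  field_simp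
  ring

/-- A highest weight vector of weight `2 n - 2 k` in the tensor square. -/
noncomputable def hw (v : V) (n k : ℕ) : V ⊗[ℂ] V :=
  ∑ i ∈ Finset.range (k + 1), hwCoeff n k i • (desc v i ⊗ₜ[ℂ] desc v (k - i))

theorem lie_E_hw {v : V} {n : ℕ} (P : triple.HasPrimitiveVectorWith v (n : ℂ)) {k : ℕ}
    (hk : k ≤ n) : ⁅E, hw v n k⁆ = 0 := by
  have h : ⁅E, hw v n k⁆ =
      (∑ i ∈ Finset.range (k + 1), (hwCoeff n k i * ((i : ℂ) * (n - i + 1))) •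
        (desc v (i - 1) ⊗ₜ[ℂ] desc v (k - i))) +
      ∑ i ∈ Finset.range (k + 1), (hwCoeff n k i * (((k - i : ℕ) : ℂ) * (n - (k - i : ℕ) + 1))) •
        (desc v i ⊗ₜ[ℂ] desc v (k - i - 1)) := by
    rw [hw, lie_sum, ← Finset.sum_add_distrib]
    refine Finset.sum_congr rfl fun i _ => ?_
    rw [lie_smul, TensorProduct.LieModule.lie_tmul_right, lie_E_desc P, lie_E_desc P, smul_add,
      TensorProduct.smul_tmul', TensorProduct.tmul_smul, smul_smul]
    simp only [TensorProduct.smul_tmul', smul_smul]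
  rw [h, Finset.sum_range_succ', Finset.sum_range_succ]
  simp only [Nat.cast_zero, zero_mul, mul_zero, zero_smul, add_zero, Nat.sub_self]
  rw [← Finset.sum_add_distrib]
  refine Finset.sum_eq_zero fun i hi => ?_
  rw [Nat.add_sub_cancel, Nat.sub_sub, ← add_smul, hwCoeff_rec hk (Finset.mem_range.mp hi),
    zero_smul]

theorem lie_H_hw {v : V} {n : ℕ} (P : triple.HasPrimitiveVectorWith v (n : ℂ)) {k : ℕ}
    (hk : k ≤ n) : ⁅H, hw v n k⁆ = ((2 * (n - k) : ℕ) : ℂ) • hw v n k := by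
  rw [hw, lie_sum, Finset.smul_sum]
  refine Finset.sum_congr rfl fun i hi => ?_
  have hi' : i ≤ k := Nat.lt_succ_iff.mp (Finset.mem_range.mp hi)
  rw [lie_smul, TensorProduct.LieModule.lie_tmul_right, lie_H_desc P, lie_H_desc P,
    TensorProduct.tmul_smul, ← TensorProduct.smul_tmul', ← add_smul, smul_comm]
  congr 1
  push_cast [hk, hi']
  ring

theorem hw_ne_zero {v : V} {n : ℕ} (P : triple.HasPrimitiveVectorWith v (n : ℂ)) {k : ℕ}
    (hk : k ≤ n) : hw v n k ≠ 0 := by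
  intro h
  have li := (desc_linearIndependent P).tmul_of_flat_left (desc_linearIndependent P)
  have li2 := li.comp (fun i : Fin (k + 1) =>
    ((⟨i, by omega⟩ : Fin (n + 1)), (⟨k - i, by omega⟩ : Fin (n + 1)))) (by
      intro a b hab
      have := congrArg (fun p => (p.1 : ℕ)) hab
      exact Fin.ext this)
  rw [hw, Finset.sum_range] at h
  have h0 := Fintype.linearIndependent_iff.mp li2 (fun i => hwCoeff n k i) h 0
  have : hwCoeff n k 0 ≠ 0 := by
    simp only [hwCoeff]
    refine div_ne_zero (mul_ne_zero (by simp) ?_) ?_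
    · exact_mod_cast mul_ne_zero (Nat.factorial_ne_zero _) (Nat.factorial_ne_zero _)
    · exact_mod_cast mul_ne_zero (Nat.factorial_ne_zero _) (Nat.factorial_ne_zero _)
  exact this h0

theorem finrank_le_spinSubspace {v : V} {n : ℕ} (P : triple.HasPrimitiveVectorWith v (n : ℂ))
    {j : ℕ} (hj : j ≤ n) : 2 * j + 1 ≤ Module.finrank ℂ (spinSubspace (V ⊗[ℂ] V) j) := by
  have Q : triple.HasPrimitiveVectorWith (hw v n (n - j)) ((2 * j : ℕ) : ℂ) :=
    ⟨hw_ne_zero P (Nat.sub_le n j), by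
      have := lie_H_hw P (Nat.sub_le n j)
      rwa [Nat.sub_sub_self hj] at this, lie_E_hw P (Nat.sub_le n j)⟩
  have h : (cyc Q).toSubmodule ≤ spinSubspace (V ⊗[ℂ] V) j :=
    le_iSup_of_le (cyc Q) (le_iSup_of_le (cyc_irreducible Q)
      (le_iSup_of_le (finrank_cyc Q) le_rfl))
  have h2 := Submodule.finrank_mono h
  have h3 : Module.finrank ℂ (cyc Q).toSubmodule = 2 * j + 1 := finrank_cyc Q
  omega

theorem iSup_spinSubspace [LieModule.IsIrreducible ℂ Sl2 V] :
    ⨆ j, spinSubspace (V ⊗[ℂ] V) j = ⊤ := by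
  obtain ⟨n, v, P, hn⟩ := exists_top V
  have hT : Module.finrank ℂ (V ⊗[ℂ] V) = (n + 1) * (n + 1) := by
    rw [Module.finrank_tensorProduct, hn]
  have key : ∀ m : ℕ, m ≤ n + 1 → m * m ≤
      Module.finrank ℂ (⨆ j ∈ Finset.range m, spinSubspace (V ⊗[ℂ] V) j : Submodule ℂ _) := by
    intro m
    induction m with
    | zero => simp
    | succ m ih =>
      intro hm
      have ih := ih (by omega)
      rw [Finset.range_add_one, Finset.iSup_insert]
      have hd : Disjoint (spinSubspace (V ⊗[ℂ] V) m)
          (⨆ j ∈ Finset.range m, spinSubspace (V ⊗[ℂ] V) j) :=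
        (iSupIndep_spinSubspace (M := V ⊗[ℂ] V) m).mono_right
          (iSup₂_le fun j hj => le_iSup₂_of_le j (Finset.mem_range.mp hj).ne le_rfl)
      have h1 := Submodule.finrank_sup_add_finrank_inf_eq (spinSubspace (V ⊗[ℂ] V) m)
        (⨆ j ∈ Finset.range m, spinSubspace (V ⊗[ℂ] V) j)
      rw [hd.eq_bot, finrank_bot] at h1
      have h2 := finrank_le_spinSubspace P (j := m) (by omega)
      nlinarith
  have h := key (n + 1) le_rfl
  have htop : (⨆ j ∈ Finset.range (n + 1), spinSubspace (V ⊗[ℂ] V) j : Submodule ℂ _) = ⊤ :=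
    Submodule.eq_top_of_finrank_eq (le_antisymm (Submodule.finrank_le _) (by rw [hT]; exact h))
  rw [eq_top_iff, ← htop]
  exact iSup₂_le fun j _ => le_iSup (spinSubspace (V ⊗[ℂ] V)) j

variable (V)

theorem isCompl_spinSubspace [LieModule.IsIrreducible ℂ Sl2 V] (j : ℕ) :
    IsCompl (spinSubspace (V ⊗[ℂ] V) j) (⨆ (i : ℕ) (_ : i ≠ j), spinSubspace (V ⊗[ℂ] V) i) := by
  refine ⟨iSupIndep_spinSubspace j, codisjoint_iff.mpr ?_⟩
  rw [eq_top_iff, ← iSup_spinSubspace]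
  refine iSup_le fun i => ?_
  by_cases h : i = j
  · subst h; exact le_sup_left
  · exact le_sup_of_le_right (le_iSup₂_of_le i h le_rfl)

/-- The projector `P ^ j` of `V ⊗ V` onto its subspace of spin `j`, along the sum of the subspaces
of all the other spins. -/
noncomputable def spinProjector [LieModule.IsIrreducible ℂ Sl2 V] (j : ℕ) :
    Module.End ℂ (V ⊗[ℂ] V) :=
  Submodule.projection _ _ (isCompl_spinSubspace V j)

end Square

end Sl2

section YangBaxter

variable {V : Type*} [AddCommGroup V] [Module ℂ V]

/-- `R` acting on the first two factors of `V ⊗ V ⊗ V`. -/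
noncomputable def R₁₂ (R : Module.End ℂ (V ⊗[ℂ] V)) : Module.End ℂ ((V ⊗[ℂ] V) ⊗[ℂ] V) :=
  R.rTensor V

/-- `R` acting on the last two factors of `V ⊗ V ⊗ V`. -/
noncomputable def R₂₃ (R : Module.End ℂ (V ⊗[ℂ] V)) : Module.End ℂ ((V ⊗[ℂ] V) ⊗[ℂ] V) :=
  (TensorProduct.assoc ℂ V V V).symm.conj (R.lTensor V)

/-- A constant R-matrix: a solution of the constant Yang–Baxter equation in braid form. -/
def IsConstantRMatrix (R : Module.End ℂ (V ⊗[ℂ] V)) : Prop :=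
  R₁₂ R * R₂₃ R * R₁₂ R = R₂₃ R * R₁₂ R * R₂₃ R

end YangBaxter

/-! ### Spin subspaces and highest weight vectors of the tensor square. -/

namespace Sl2

section Square

variable {V : Type*} [AddCommGroup V] [Module ℂ V] [LieRingModule Sl2 V] [LieModule ℂ Sl2 V]
  [FiniteDimensional ℂ V]

/-! Write `n = 2s`, let `v` be a highest weight vector of `V`, and let `hₖ = hw v n k`, which has
spin `n - k`. Suppose `R ≠ 0` and `r_n = 0`, and let `n - m` be the largest spin on which `R` does
not vanish, with `c = r_{n-m} ≠ 0`; then `m ≥ 1`.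

Since `R` commutes with `F` and kills `hₖ` for `k < m`, it kills every `Fⁱv ⊗ Fʲv` with `i + j < m`.
For `i + j = m` it gives `(-1)ⁱ ρ hₘ` with `ρ ≠ 0` (`map_desc_tmul_desc`).

Test the Yang–Baxter equation on `a = hₘ ⊗ v`, and put `b = v ⊗ hₘ`. Only one term of each expansion
survives, so `R₁₂ a = c a`, `R₂₃ a = β b`, `R₁₂ b = γ a` with `β, γ ≠ 0`. The two sides become `cβγ
a` and `β²γ b`. As `m ≥ 1`, the term `Fᵐv ⊗ v ⊗ v` occurs in `a` but not in `b`, a contradiction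
(`not_isConstantRMatrix`). -/

theorem lie_mem_spinSubspace {M : Type*} [AddCommGroup M] [Module ℂ M] [LieRingModule Sl2 M]
    [LieModule ℂ Sl2 M] {j : ℕ} (x : Sl2) {m : M} (hm : m ∈ spinSubspace M j) :
    ⁅x, m⁆ ∈ spinSubspace M j := by
  have h : spinSubspace M j ≤ (spinSubspace M j).comap (LieModule.toEnd ℂ Sl2 M x) := by
    refine iSup_le fun U => iSup_le fun hU => iSup_le fun hd => fun y hy => ?_
    have hle : U.toSubmodule ≤ spinSubspace M j :=
      le_iSup_of_le U (le_iSup_of_le hU (le_iSup_of_le hd le_rfl))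
    exact hle (U.lie_mem hy)
  exact h hm

theorem hw_mem_spinSubspace {v : V} {n k : ℕ} (P : triple.HasPrimitiveVectorWith v (n : ℂ))
    (hk : k ≤ n) : hw v n k ∈ spinSubspace (V ⊗[ℂ] V) (n - k) := by
  have Q : triple.HasPrimitiveVectorWith (hw v n k) ((2 * (n - k) : ℕ) : ℂ) :=
    ⟨hw_ne_zero P hk, lie_H_hw P hk, lie_E_hw P hk⟩
  have h : (cyc Q).toSubmodule ≤ spinSubspace (V ⊗[ℂ] V) (n - k) :=
    le_iSup_of_le (cyc Q) (le_iSup_of_le (cyc_irreducible Q)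
      (le_iSup_of_le (finrank_cyc Q) le_rfl))
  exact h (Submodule.subset_span ⟨0, rfl⟩)

theorem hwCoeff_ne_zero (n k i : ℕ) : hwCoeff n k i ≠ 0 := by
  have h (a : ℕ) : ((a.factorial : ℕ) : ℂ) ≠ 0 := by exact_mod_cast a.factorial_ne_zero
  simp [hwCoeff, h]

/-- The sign `(-1)ⁱ` cancels the one inside `hwCoeff`, leaving a sum of positive reals. -/
theorem sum_neg_one_pow_mul_hwCoeff_ne_zero (n k : ℕ) :
    ∑ i ∈ Finset.range (k + 1), (-1 : ℂ) ^ i * hwCoeff n k i ≠ 0 := by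
  have h : ∑ i ∈ Finset.range (k + 1), (-1 : ℂ) ^ i * hwCoeff n k i =
      ((∑ i ∈ Finset.range (k + 1), ((n - i).factorial * (n - k + i).factorial : ℝ) /
        (i.factorial * (k - i).factorial) : ℝ) : ℂ) := by
    push_cast
    refine Finset.sum_congr rfl fun i _ => ?_
    rw [hwCoeff, mul_div_assoc, ← mul_assoc, ← mul_pow]
    norm_num
  rw [h, Complex.ofReal_ne_zero]
  refine (Finset.sum_pos (fun i _ => ?_) (Finset.nonempty_range_add_one)).ne'
  positivity

/-! ### Invariant operators as scalars on the spin subspaces. -/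

section Projectors

variable [LieModule.IsIrreducible ℂ Sl2 V]

theorem spinProjector_apply {i j : ℕ} {x : V ⊗[ℂ] V} (hx : x ∈ spinSubspace (V ⊗[ℂ] V) i) :
    spinProjector V j x = if i = j then x else 0 := by
  split_ifs with h
  · subst h
    exact Submodule.projection_apply_of_mem_left (isCompl_spinSubspace V i) hx
  · exact (Submodule.projection_apply_eq_zero_iff (isCompl_spinSubspace V j)).mpr
      (Submodule.mem_iSup_of_mem i (Submodule.mem_iSup_of_mem h hx))

theorem sum_smul_spinProjector_apply {N : ℕ} (r : Fin N → ℂ) (i : ℕ) {x : V ⊗[ℂ] V}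
    (hx : x ∈ spinSubspace (V ⊗[ℂ] V) i) :
    (∑ j, r j • spinProjector V (j : ℕ)) x = (if h : i < N then r ⟨i, h⟩ else 0) • x := by
  simp only [LinearMap.sum_apply, LinearMap.smul_apply, spinProjector_apply hx, smul_ite,
    smul_zero]
  split_ifs with h
  · rw [Finset.sum_eq_single ⟨i, h⟩]
    · simp
    · rintro b - hb
      exact if_neg fun h' => hb (Fin.ext h'.symm)
    · simp
  · rw [zero_smul]
    exact Finset.sum_eq_zero fun b _ => if_neg fun (h' : i = b) => h (h' ▸ b.2)

/-- The operator is a scalar on each spin subspace; these are stable under `sl₂` and span `V ⊗ V`.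
-/
theorem sum_smul_spinProjector_lie {N : ℕ} (r : Fin N → ℂ) (y : Sl2) (x : V ⊗[ℂ] V) :
    (∑ j, r j • spinProjector V (j : ℕ)) ⁅y, x⁆ =
      ⁅y, (∑ j, r j • spinProjector V (j : ℕ)) x⁆ := by
  have hx : x ∈ ⨆ j, spinSubspace (V ⊗[ℂ] V) j := by rw [iSup_spinSubspace]; trivial
  induction hx using Submodule.iSup_induction' with
  | mem i x hx =>
    rw [sum_smul_spinProjector_apply r i hx,
      sum_smul_spinProjector_apply r i (lie_mem_spinSubspace y hx), lie_smul]
  | zero => simp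
  | add a b _ _ ha hb => rw [lie_add, map_add, map_add, lie_add, ha, hb]

end Projectors

/-! ### Invariant operators on the vectors `Fⁱv ⊗ Fʲv`. -/

variable {R : Module.End ℂ (V ⊗[ℂ] V)} {v : V} {n : ℕ}

/-- Applying `R` to `F(Fⁱv ⊗ Fʲv)` with `i + j = k - 1` gives zero, so moving one `F` between the
factors flips the sign of the image. All images at level `k` are thus `±R(v ⊗ Fᵏv)`, and expanding
`R(hw v n k)` determines that vector. -/
theorem map_desc_tmul_desc {k : ℕ} {c : ℂ} (hF : ∀ x, R ⁅F, x⁆ = ⁅F, R x⁆)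
    (hR : R (hw v n k) = c • hw v n k)
    (h0 : ∀ i j, i + j < k → R (desc v i ⊗ₜ desc v j) = 0) {i j : ℕ} (hij : i + j = k) :
    R (desc v i ⊗ₜ desc v j) =
      ((-1) ^ i * (c / ∑ i ∈ Finset.range (k + 1), (-1 : ℂ) ^ i * hwCoeff n k i)) •
        hw v n k := by
  have hS := sum_neg_one_pow_mul_hwCoeff_ne_zero n k
  have key : ∀ i j, i + j = k →
      R (desc v i ⊗ₜ desc v j) = (-1 : ℂ) ^ i • R (desc v 0 ⊗ₜ desc v k) := by
    intro i
    induction i with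
    | zero => rintro j h; rw [zero_add] at h; simp [h]
    | succ i ih =>
      intro j h
      have h1 := hF (desc v i ⊗ₜ desc v j)
      rw [h0 i j (by omega), lie_zero, TensorProduct.LieModule.lie_tmul_right, lie_F_desc,
        lie_F_desc, map_add, ih (j + 1) (by omega)] at h1
      rw [eq_neg_of_add_eq_zero_left h1, pow_succ, mul_neg_one, neg_smul]
  have h1 : c • hw v n k =
      (∑ i ∈ Finset.range (k + 1), (-1 : ℂ) ^ i * hwCoeff n k i) •
        R (desc v 0 ⊗ₜ desc v k) := by
    rw [← hR]
    conv_lhs => rw [hw]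
    rw [map_sum, Finset.sum_smul]
    refine Finset.sum_congr rfl fun i hi => ?_
    rw [map_smul, key i (k - i) (by have := Finset.mem_range.mp hi; omega), smul_smul, mul_comm]
  rw [key i j hij, mul_smul, div_eq_inv_mul, mul_smul, h1, inv_smul_smul₀ hS]

/-- Induction on the level `i + j`, using the preceding formula with eigenvalue `0`. -/
theorem map_desc_tmul_desc_eq_zero {m : ℕ} (hF : ∀ x, R ⁅F, x⁆ = ⁅F, R x⁆)
    (hR : ∀ k < m, R (hw v n k) = 0) (i j : ℕ) (hij : i + j < m) :
    R (desc v i ⊗ₜ desc v j) = 0 := by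
  induction hk : i + j using Nat.strong_induction_on generalizing i j with
  | _ k ih =>
    rw [map_desc_tmul_desc (c := 0) (k := k) hF
      (by rw [hR k (by omega), zero_smul]) (fun a b hab => ih (a + b) hab a b (by omega) rfl) hk]
    simp

theorem exists_dual_desc (P : triple.HasPrimitiveVectorWith v (n : ℂ)) {m : ℕ} (hm : m ≤ n) :
    ∃ g : V →ₗ[ℂ] ℂ, ∀ i ≤ n, g (desc v i) = if i = m then 1 else 0 := by
  obtain ⟨g, hg⟩ := LinearMap.exists_extend
    ((Finsupp.lapply (⟨m, by omega⟩ : Fin (n + 1))).comp (desc_linearIndependent P).repr)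
  refine ⟨g, fun i hi => ?_⟩
  have hmem : desc v i ∈ Submodule.span ℂ (Set.range fun k : Fin (n + 1) => desc v k) :=
    Submodule.subset_span ⟨⟨i, by omega⟩, rfl⟩
  have h := LinearMap.congr_fun hg ⟨desc v i, hmem⟩
  rw [LinearMap.comp_apply, LinearMap.comp_apply,
    (desc_linearIndependent P).repr_eq_single ⟨i, by omega⟩ ⟨desc v i, hmem⟩ rfl] at h
  simpa [Finsupp.single_apply] using h

end Square

end Sl2

/-! ### The two actions on pure tensors of the triple product. -/

section YangBaxter

variable {V : Type*} [AddCommGroup V] [Module ℂ V]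

theorem R₁₂_tmul (R : Module.End ℂ (V ⊗[ℂ] V)) (x : V ⊗[ℂ] V) (z : V) :
    R₁₂ R (x ⊗ₜ z) = R x ⊗ₜ z := rfl

theorem R₂₃_assoc_symm_tmul (R : Module.End ℂ (V ⊗[ℂ] V)) (z : V) (x : V ⊗[ℂ] V) :
    R₂₃ R ((TensorProduct.assoc ℂ V V V).symm (z ⊗ₜ x)) =
      (TensorProduct.assoc ℂ V V V).symm (z ⊗ₜ R x) := by
  simp [R₂₃, LinearEquiv.conj_apply]

end YangBaxter

/-! ### The contradiction with the Yang–Baxter equation. -/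

namespace Sl2

variable {V : Type*} [AddCommGroup V] [Module ℂ V] [LieRingModule Sl2 V] [LieModule ℂ Sl2 V]
  [FiniteDimensional ℂ V] {R : Module.End ℂ (V ⊗[ℂ] V)} {v : V} {n : ℕ}

theorem not_isConstantRMatrix (P : triple.HasPrimitiveVectorWith v (n : ℂ))
    (hF : ∀ x, R ⁅F, x⁆ = ⁅F, R x⁆) {m : ℕ} {c : ℂ} (hm : m ≠ 0) (hmn : m ≤ n) (hc : c ≠ 0)
    (h0 : ∀ k < m, R (hw v n k) = 0) (hR : R (hw v n m) = c • hw v n m) :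
    ¬ IsConstantRMatrix R := by
  intro hYB
  have hz := map_desc_tmul_desc_eq_zero hF h0
  obtain ⟨ρ, hρ, hρR⟩ : ∃ ρ : ℂ, ρ ≠ 0 ∧ ∀ i j, i + j = m →
      R (desc v i ⊗ₜ desc v j) = ((-1) ^ i * ρ) • hw v n m :=
    ⟨_, div_ne_zero hc (sum_neg_one_pow_mul_hwCoeff_ne_zero n m),
      fun i j hij => map_desc_tmul_desc hF hR hz hij⟩
  set A := (TensorProduct.assoc ℂ V V V).symm with hA
  set a : (V ⊗[ℂ] V) ⊗[ℂ] V := hw v n m ⊗ₜ desc v 0 with ha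
  set b : (V ⊗[ℂ] V) ⊗[ℂ] V := A (desc v 0 ⊗ₜ hw v n m) with hb
  have ha' : a = ∑ i ∈ Finset.range (m + 1),
      hwCoeff n m i • A (desc v i ⊗ₜ (desc v (m - i) ⊗ₜ desc v 0)) := by
    simp only [ha, hw, TensorProduct.sum_tmul, TensorProduct.smul_tmul', hA,
      TensorProduct.assoc_symm_tmul]
  have hb' : b = ∑ i ∈ Finset.range (m + 1),
      hwCoeff n m i • ((desc v 0 ⊗ₜ desc v i) ⊗ₜ desc v (m - i)) := by
    simp only [hb, hw, TensorProduct.tmul_sum, TensorProduct.tmul_smul, map_sum, map_smul, hA,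
      TensorProduct.assoc_symm_tmul]
  have h12a : R₁₂ R a = c • a := by rw [ha, R₁₂_tmul, hR, TensorProduct.smul_tmul']
  have h23a : R₂₃ R a = (hwCoeff n m 0 * ((-1) ^ m * ρ)) • b := by
    -- For `i > 0` the last two factors have level `m - i < m` and are killed by `R`. In `h12b`
    -- below, the same argument leaves only `i = m`.
    rw [ha', map_sum, Finset.sum_eq_single 0]
    · rw [map_smul, R₂₃_assoc_symm_tmul, Nat.sub_zero, hρR m 0 (by omega),
        TensorProduct.tmul_smul, map_smul, smul_smul]
    · intro i _ hi
      rw [map_smul, R₂₃_assoc_symm_tmul, hz _ _ (by omega), TensorProduct.tmul_zero, map_zero,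
        smul_zero]
    · simp
  have h12b : R₁₂ R b = (hwCoeff n m m * ρ) • a := by
    rw [hb', map_sum, Finset.sum_eq_single m]
    · rw [map_smul, R₁₂_tmul, Nat.sub_self, hρR 0 m (by omega), pow_zero, one_mul,
        ← TensorProduct.smul_tmul', mul_smul]
    · intro i hi him
      have := Finset.mem_range.mp hi
      rw [map_smul, R₁₂_tmul, hz _ _ (by omega), TensorProduct.zero_tmul, smul_zero]
    · simp
  have h := LinearMap.congr_fun hYB a
  simp only [Module.End.mul_apply, h12a, h23a, h12b, map_smul, smul_smul] at h
  obtain ⟨g, hg⟩ := exists_dual_desc P hmn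
  obtain ⟨f, hf⟩ := exists_dual_desc P (Nat.zero_le n)
  -- `φ` reads off the coefficient of `Fᵐv ⊗ v ⊗ v`, which separates `a` from `b`.
  let φ : (V ⊗[ℂ] V) ⊗[ℂ] V →ₗ[ℂ] ℂ :=
    LinearMap.mul' ℂ ℂ ∘ₗ TensorProduct.map (LinearMap.mul' ℂ ℂ ∘ₗ TensorProduct.map g f) f
  have hφ (x y z : V) : φ ((x ⊗ₜ y) ⊗ₜ z) = g x * f y * f z := rfl
  have hφb : φ b = 0 := by
    rw [hb', map_sum]
    refine Finset.sum_eq_zero fun i _ => ?_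
    rw [map_smul, hφ, hg 0 (by omega), if_neg hm.symm]
    simp
  have hφa : φ a = hwCoeff n m m := by
    rw [ha', map_sum, Finset.sum_eq_single m]
    · rw [map_smul, hA, TensorProduct.assoc_symm_tmul, hφ, hg m hmn, Nat.sub_self,
        hf 0 (by omega)]
      simp
    · intro i hi him
      have := Finset.mem_range.mp hi
      rw [map_smul, hA, TensorProduct.assoc_symm_tmul, hφ, hg i (by omega), if_neg him]
      simp
    · simp
  have h2 := congrArg φ h
  rw [map_smul, map_smul, hφa, hφb, smul_zero, smul_eq_mul] at h2
  simp [hwCoeff_ne_zero, hρ, hc] at h2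

end Sl2

theorem lemma6 {V : Type*} [AddCommGroup V] [Module ℂ V] [LieRingModule Sl2 V]
    [LieModule ℂ Sl2 V] [FiniteDimensional ℂ V] [LieModule.IsIrreducible ℂ Sl2 V]
    (n : ℕ) (hn : 1 ≤ n) (hV : Module.finrank ℂ V = n + 1) :
    ¬ ∃ (R : Module.End ℂ (V ⊗[ℂ] V)) (r : Fin (n + 1) → ℂ),
      IsConstantRMatrix R ∧ R = ∑ j : Fin (n + 1), r j • Sl2.spinProjector V j ∧
        r (Fin.last n) = 0 ∧ R ≠ 0 := by
  classical
  rintro ⟨R, r, hYB, rfl, hlast, hne⟩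
  obtain ⟨d, v, P, hd⟩ := Sl2.exists_top V
  obtain rfl : d = n := by omega
  -- Indexing by the defect `m = d - j` makes `Nat.find` select the largest spin with nonzero
  -- coefficient.
  have hex : ∃ m, ∃ h : m ≤ d, r ⟨d - m, by omega⟩ ≠ 0 := by
    by_contra! hall
    refine hne (Finset.sum_eq_zero fun j _ => ?_)
    have hj : (⟨d - (d - j), by omega⟩ : Fin (d + 1)) = j := Fin.ext (by simp; omega)
    have := hall (d - j) (Nat.sub_le _ _)
    rw [hj] at this
    rw [this, zero_smul]
  obtain ⟨hm, hr⟩ := Nat.find_spec hex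
  have hhw : ∀ k, (hk : k ≤ d) → (∑ j, r j • Sl2.spinProjector V (j : ℕ)) (Sl2.hw v d k) =
      r ⟨d - k, by omega⟩ • Sl2.hw v d k := fun k hk => by
    rw [Sl2.sum_smul_spinProjector_apply r _ (Sl2.hw_mem_spinSubspace P hk),
      dif_pos (by omega)]
  refine Sl2.not_isConstantRMatrix P (Sl2.sum_smul_spinProjector_lie r Sl2.F) (fun h => ?_) hm hr
    (fun k hk => ?_) (hhw _ hm) hYB
  -- Defect `0` is the top spin, whose coefficient vanishes by assumption.
  · refine hr (Eq.trans (congrArg r (Fin.ext ?_)) hlast)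
    simp only [Fin.val_last]
    omega
  · have h := Nat.find_min hex hk
    push Not at h
    rw [hhw k (by omega), h (by omega), zero_smul]
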